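/- Let $k,N,p_0\ge 1$, $m=k+N$. Let $\{(x_t,u_t)\}_{t\in\mathbb Z}$ be a process on a probability space with $x_t$ $\mathbb R^k$-valued and $u_t$ $\mathbb R^N$-valued, square-integrable, $\mathbb E[x_t]=\mu_x$ and $\mathbb E[u_t]=0$ for all $t$. Put $\bar z_t=((x_t-\mu_x)',u_t')'$. Let $\mathscr H_t$ be the $L^2$-closure of the set of finite sums $\sum_{s\le t}A_s\bar z_s$ with $A_s\in\mathbb R^{m\times m}$, let $\mathscr P_{t-1}$ be the orthogonal projection of $L^2(\Omega;\mathbb R^m)$ onto $\mathscr H_{t-1}$, let $\mathscr P^{(p_0)}_{t-1}$ be the orthogonal projection onto $\{\sum_{j=1}^{p_0}A_j\bar z_{t-j}: A_j\in\mathbb R^{m\times m}\}$, and let $\varepsilon_t=(\varepsilon_{x,t}',\varepsilon_{u,t}')'=\bar z_t-\mathscr P_{t-1}[\bar z_t]$. Assumption 1 (with lag order $p_0$): (A1.1) $\{\bar z_t\}$ is covariance-stationary, $\bigcap_t\mathscr H_t=\{0\}$, and $\mathscr P_{t-1}[\bar z_t]=\mathscr P^{(p_0)}_{t-1}[\bar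 z_t]$ for all $t$. (A1.2) For some $\delta>0$, $\{\varepsilon_t\}$ is strongly mixing with mixing coefficients satisfying $\sum_{\ell\ge1}\alpha_\varepsilon(\ell)^{\delta/(2+\delta)}<\infty$, and $\mathbb E\|\varepsilon_t\|^{4+2\delta}<\infty$ for all $t$; moreover $\Sigma=\mathbb E[\varepsilon_t\varepsilon_t']$ is positive definite. Here $\alpha_\varepsilon(\ell)$ is the supremum of $|\mathbb P(A\cap B)-\mathbb P(A)\mathbb P(B)|$ over all $t$, $A\in\sigma(\varepsilon_s:s\le t-\ell)$ and $B\in\sigma(\varepsilon_s:s\ge t)$. Partition $\Sigma$ and $m\times m$ matrices $\Psi_j$ into blocks $xx,xu,ux,uu$ according to $m=k+N$. Consider the conditions: - strict exogeneity: $\mathbb E[u_tx_s']=0$ for all $t,s$; - present-and-past exogeneity: $\mathbb E[u_tx_s']=0$ for all $t$ and all $s\le t$; - pre-determined: $\mathbb E[x_t\varepsilon_{u,t+h}']=0$ for all $t$ and all $h\ge0$; - BD: $\bar z_t=\sum_{j=1}^{p_0}\Psi_j\bar z_{t-j}+\varepsilon_t$ for all $t$ with all $\Psi_j$ block-diagonal,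 and $\Sigma$ is block-diagonal; - EBD: $\bar z_t=\sum_{j=1}^{p_0}\Psi_j\bar z_{t-j}+\varepsilon_t$ for all $t$ with unrestricted $\Psi_j$, and $\Sigma$ is block-diagonal. Proposition 2. Under Assumption 1: (i) Strict exogeneity is equivalent to BD. (ii) The pre-determined condition is equivalent to EBD, and EBD is equivalent to $\Sigma_{xu}=0$. (iii) For all $k,N,p_0\ge1$, within the class of processes satisfying Assumption 1 with lag order $p_0$, $\mathrm{BD}\subsetneq\{\text{present-and-past exogeneity}\}\cap\mathrm{EBD}\subsetneq\mathrm{EBD}$. Moreover, scalar VAR(1) processes ($k=N=p_0=1$) separate the classes: for every $\gamma\ne0$ there is a process satisfying Assumption 1, with $\Psi_1=\begin{pmatrix}0&\gamma\\0&0\end{pmatrix}$, that satisfies EBD and present-and-past exogeneity but not BD; and for all $\rho_x,\rho_u,\alpha$ with $|\rho_x|<1$, $|\rho_u|<1$, $\rho_u\neq0$, $\alpha\ne0$ there is a process satisfying Assumption 1, with $\Psi_1=\begin{pmatrix}\rho_x&\alpha\\0&\rho_u\end{pmatrix}$, that satisfies EBD but not present-and-past exogeneity. -/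

import Mathlib

open MeasureTheory ProbabilityTheory Filter Topology

universe u

/-- A data-generating process for a `k`-dimensional regressor process `x` and an `N`-dimensional
disturbance process `u`, both indexed by `ℤ`, on some probability space: all coordinates are
square-integrable, `E[x t] = μx` for all `t`, and `E[u t] = 0` for all `t`. -/
structure DGP (k N : ℕ) : Type (u + 1) where
  /-- the sample space -/
  Ω : Type u
  /-- its σ-algebra -/
  mΩ : MeasurableSpace Ω
  /-- the probability measure -/
  P : Measure Ω
  isProb : IsProbabilityMeasure P
  /-- regressors: time, coordinate, sample point -/
  x : ℤ → Fin k → Ω → ℝ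
  /-- disturbances: time, coordinate, sample point -/
  u : ℤ → Fin N → Ω → ℝ
  /-- mean of the regressors -/
  μx : Fin k → ℝ
  memLp_x : ∀ t i, MemLp (x t i) 2 P
  memLp_u : ∀ t i, MemLp (u t i) 2 P
  mean_x : ∀ t i, ∫ ω, x t i ω ∂P = μx i
  mean_u : ∀ t i, ∫ ω, u t i ω ∂P = 0

attribute [instance] DGP.mΩ DGP.isProb

namespace DGP

noncomputable section

variable {k N : ℕ} (D : DGP.{u} k N)

/-- The centered stacked process `z̄ t = ((x t - μx)', (u t)')'`, coordinate by coordinate. -/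
def zc (t : ℤ) : Fin k ⊕ Fin N → D.Ω → ℝ
  | Sum.inl i => fun ω => D.x t i ω - D.μx i
  | Sum.inr i => D.u t i

theorem memLp_zc (t : ℤ) (i : Fin k ⊕ Fin N) : MemLp (D.zc t i) 2 D.P := by
  cases i with
  | inl i => exact (D.memLp_x t i).sub (memLp_const (D.μx i))
  | inr i => exact D.memLp_u t i

/-- The coordinates of `z̄ t` as elements of the Hilbert space `L²(Ω, P)`. -/
def zbar (t : ℤ) (i : Fin k ⊕ Fin N) : Lp ℝ 2 D.P := (D.memLp_zc t i).toLp (D.zc t i)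

/-- `H t`: the closed linear span in `L²` of all coordinates of `z̄ t, z̄ (t-1), …`.
A random vector all of whose coordinates lie in `H t` is an `L²`-limit of finite sums
`∑ A_s z̄ s`, `s ≤ t`, with matrix coefficients `A_s`. -/
def past (t : ℤ) : Submodule ℝ (Lp ℝ 2 D.P) :=
  (Submodule.span ℝ {v | ∃ s : ℤ, s ≤ t ∧ ∃ i, v = D.zbar s i}).topologicalClosure

/-- The linear span of all coordinates of `z̄ (t-1), …, z̄ (t-p)`. -/
def finitePast (p : ℕ) (t : ℤ) : Submodule ℝ (Lp ℝ 2 D.P) :=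
  Submodule.span ℝ
    (Set.range fun q : Fin p × (Fin k ⊕ Fin N) => D.zbar (t - ((q.1 : ℤ) + 1)) q.2)

instance (t : ℤ) : CompleteSpace (D.past t) := by
  unfold past
  infer_instance

instance (p : ℕ) (t : ℤ) : FiniteDimensional ℝ (D.finitePast p t) :=
  FiniteDimensional.span_of_finite ℝ (Set.finite_range _)

/-- The one-step-ahead innovation `ε t = z̄ t - P_{t-1}[z̄ t]`, where `P_{t-1}` is the orthogonal
projection onto `H (t-1)`. -/
def innov (t : ℤ) (i : Fin k ⊕ Fin N) : Lp ℝ 2 D.P :=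
  D.zbar t i - (D.past (t - 1)).starProjection (D.zbar t i)

/-- The innovation covariance matrix `Σ = E[ε t (ε t)']` (at time `t`). -/
def innovCov (t : ℤ) : Matrix (Fin k ⊕ Fin N) (Fin k ⊕ Fin N) ℝ :=
  Matrix.of fun i j => ∫ ω, D.innov t i ω * D.innov t j ω ∂D.P

/-- The σ-algebra generated by the innovations up to time `t`. -/
abbrev sigmaPast (t : ℤ) : MeasurableSpace D.Ω :=
  ⨆ (s : ℤ) (_ : s ≤ t) (i : Fin k ⊕ Fin N),
    MeasurableSpace.comap (fun ω => D.innov s i ω) (inferInstance : MeasurableSpace ℝ)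

/-- The σ-algebra generated by the innovations from time `t` onwards. -/
abbrev sigmaFuture (t : ℤ) : MeasurableSpace D.Ω :=
  ⨆ (s : ℤ) (_ : t ≤ s) (i : Fin k ⊕ Fin N),
    MeasurableSpace.comap (fun ω => D.innov s i ω) (inferInstance : MeasurableSpace ℝ)

/-- The strong (`α`-)mixing coefficients of the innovation sequence: the supremum of
`|P(A ∩ B) - P(A) P(B)|` over all times `t`, all `A` in the σ-algebra of the innovations up to
`t - ℓ` and all `B` in the σ-algebra of the innovations from `t` onwards. -/
def alphaMix (ℓ : ℕ) : ℝ :=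
  sSup {r | ∃ (t : ℤ) (A B : Set D.Ω), MeasurableSet[D.sigmaPast (t - ℓ)] A ∧
    MeasurableSet[D.sigmaFuture t] B ∧ r = |D.P.real (A ∩ B) - D.P.real A * D.P.real B|}

/-- The standing assumption, with lag order `p`. -/
structure FinitePredictorExact (p : ℕ) : Prop where
  one_le : 1 ≤ p
  /-- the process is covariance-stationary -/
  stationary : ∀ (t h : ℤ) (i j : Fin k ⊕ Fin N),
    cov[D.zc (t + h) i, D.zc t j; D.P] = cov[D.zc h i, D.zc 0 j; D.P]
  /-- the process is purely nondeterministic -/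
  nondeterministic : ⨅ t : ℤ, D.past t = ⊥
  /-- prediction from the whole past equals prediction from the last `p` observations -/
  exact_predictor : ∀ (t : ℤ) (i : Fin k ⊕ Fin N),
    (D.past (t - 1)).starProjection (D.zbar t i) =
      (D.finitePast p t).starProjection (D.zbar t i)
  /-- the innovations are strongly mixing at a summable rate and have finite moments -/
  mixing_moments : ∃ δ : ℝ, 0 < δ ∧
    Tendsto D.alphaMix atTop (𝓝 0) ∧
    Summable (fun ℓ : ℕ => D.alphaMix (ℓ + 1) ^ (δ / (2 + δ))) ∧
    ∀ t : ℤ, MemLp (fun ω => WithLp.toLp 2 (fun i => D.innov t i ω))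
      (ENNReal.ofReal (4 + 2 * δ)) D.P
  /-- the innovation covariance matrix is positive definite -/
  posDef : ∀ t : ℤ, (D.innovCov t).PosDef

/-- `z̄ t = ∑_{j=1}^{p} Ψ_j z̄ (t-j) + ε t` in `L²` for all `t` (`Ψ j` is the coefficient of lag
`j + 1`). -/
def IsVAR (p : ℕ) (Ψ : Fin p → Matrix (Fin k ⊕ Fin N) (Fin k ⊕ Fin N) ℝ) : Prop :=
  ∀ (t : ℤ) (i : Fin k ⊕ Fin N),
    D.zbar t i = (∑ j : Fin p, ∑ l, Ψ j i l • D.zbar (t - ((j : ℤ) + 1)) l) + D.innov t i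

/-- `Σ_xu = 0`. -/
def SigmaXUZero : Prop := ∀ t : ℤ, (D.innovCov t).toBlocks₁₂ = 0

/-- Covariance-based strict exogeneity: `E[u_t x_s'] = 0` for all `t, s`. -/
def StrictlyExogenous : Prop :=
  ∀ (t s : ℤ) (i : Fin N) (j : Fin k), ∫ ω, D.u t i ω * D.x s j ω ∂D.P = 0

/-- Covariance-based present-and-past exogeneity: `E[u_t x_s'] = 0` for all `s ≤ t`. -/
def PresentPastExogenous : Prop :=
  ∀ (t s : ℤ), s ≤ t → ∀ (i : Fin N) (j : Fin k), ∫ ω, D.u t i ω * D.x s j ω ∂D.P = 0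

/-- The regressors are pre-determined: `E[x_t (ε_{u,t}, ε_{u,t+1}, …)'] = 0` for all `t`. -/
def PreDetermined : Prop :=
  ∀ (t : ℤ) (h : ℕ) (j : Fin k) (i : Fin N),
    ∫ ω, D.x t j ω * D.innov (t + h) (Sum.inr i) ω ∂D.P = 0

/-- The block-diagonal condition: VAR(`p`) with block-diagonal coefficients and block-diagonal
innovation covariance. -/
def BD (p : ℕ) : Prop :=
  (∃ Ψ : Fin p → Matrix (Fin k ⊕ Fin N) (Fin k ⊕ Fin N) ℝ, D.IsVAR p Ψ ∧
    ∀ j, (Ψ j).toBlocks₁₂ = 0 ∧ (Ψ j).toBlocks₂₁ = 0) ∧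
  ∀ t : ℤ, (D.innovCov t).toBlocks₁₂ = 0 ∧ (D.innovCov t).toBlocks₂₁ = 0

/-- The error-block-diagonal condition: VAR(`p`) with unrestricted coefficients and
block-diagonal innovation covariance. -/
def EBD (p : ℕ) : Prop :=
  (∃ Ψ : Fin p → Matrix (Fin k ⊕ Fin N) (Fin k ⊕ Fin N) ℝ, D.IsVAR p Ψ) ∧
  ∀ t : ℤ, (D.innovCov t).toBlocks₁₂ = 0 ∧ (D.innovCov t).toBlocks₂₁ = 0

end

/-- The class of data-generating processes that satisfy the standing assumption and BD. -/
def classBD (k N p : ℕ) : Set (DGP.{u} k N) := {D | D.FinitePredictorExact p ∧ D.BD p}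

/-- The class of data-generating processes that satisfy the standing assumption and EBD. -/
def classEBD (k N p : ℕ) : Set (DGP.{u} k N) := {D | D.FinitePredictorExact p ∧ D.EBD p}

/-- The class of data-generating processes that satisfy the standing assumption and
present-and-past exogeneity. -/
def classPP (k N p : ℕ) : Set (DGP.{u} k N) :=
  {D | D.FinitePredictorExact p ∧ D.PresentPastExogenous}

end DGP

/-!
Everything takes place in `L²`, between closed linear spans of the past. Since the process is purely
nondeterministic, its innovations span its past (Wold). Under BD the blocks `x - μx` and `u` evolve
separately, so each block has its own part of the innovations as innovation process; these parts are
uncorrelated at all times, hence so are the blocks. Conversely, under strict exogeneity the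
off-diagonal blocks of the coefficients can be deleted without violating the Yule–Walker equations.
Innovations are orthogonal to the past, so pre-determinedness only restricts the contemporaneous
covariance `Σ_xu`.

The classes are separated by causal Gaussian VAR(1) processes with standard normal innovations and
block triangular coefficient `[[R, A], [0, S]]`, `A ≠ 0`. As soon as `x_t` and `u_t` are
uncorrelated, `A` makes `x_{t+1}` correlated with `u_t`, which excludes BD. If `S = 0`, then `u`
is an innovation process, hence orthogonal to the present and past of `x`; if `S` is invertible,
it carries the correlation of `x_{t+1}` with `u_t` over to `u_{t+1}`, which excludes
present-and-past exogeneity.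
-/

section ClosedPast

variable {𝕜 E T ι κ : Type*} [RCLike 𝕜] [NormedAddCommGroup E] [InnerProductSpace 𝕜 E]
  [Preorder T]

variable (𝕜) in
/-- The closed linear span of the values up to time `t` of a family of processes: everything that
can be predicted linearly from the history of `z` at time `t`. -/
def closedPast (z : T → ι → E) (t : T) : Submodule 𝕜 E :=
  (Submodule.span 𝕜 {v | ∃ s, s ≤ t ∧ ∃ i, v = z s i}).topologicalClosure

theorem isClosed_closedPast (z : T → ι → E) (t : T) : IsClosed (closedPast 𝕜 z t : Set E) :=
  Submodule.isClosed_topologicalClosure _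

instance [CompleteSpace E] (z : T → ι → E) (t : T) : CompleteSpace (closedPast 𝕜 z t) :=
  (isClosed_closedPast z t).completeSpace_coe

theorem mem_closedPast (z : T → ι → E) {s t : T} (h : s ≤ t) (i : ι) :
    z s i ∈ closedPast 𝕜 z t :=
  Submodule.le_topologicalClosure _ (Submodule.subset_span ⟨s, h, i, rfl⟩)

theorem closedPast_le {z : T → ι → E} {t : T} {K : Submodule 𝕜 E} (hK : IsClosed (K : Set E))
    (h : ∀ s ≤ t, ∀ i, z s i ∈ K) : closedPast 𝕜 z t ≤ K := by
  refine Submodule.topologicalClosure_minimal _ (Submodule.span_le.2 ?_) hK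
  rintro v ⟨s, hs, i, rfl⟩
  exact h s hs i

theorem closedPast_mono (z : T → ι → E) : Monotone (closedPast 𝕜 z) := fun _ _ hst =>
  closedPast_le (isClosed_closedPast _ _) fun _ hr => mem_closedPast z (hr.trans hst)

theorem closedPast_comp_le (z : T → ι → E) (f : κ → ι) (t : T) :
    closedPast 𝕜 (fun s a => z s (f a)) t ≤ closedPast 𝕜 z t :=
  closedPast_le (isClosed_closedPast _ _) fun _ hs a => mem_closedPast z hs (f a)

theorem inner_eq_zero_of_mem_closedPast {z : T → ι → E} {t : T} {w v : E}
    (h : ∀ s ≤ t, ∀ i, inner 𝕜 w (z s i) = 0) (hv : v ∈ closedPast 𝕜 z t) :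
    inner 𝕜 w v = 0 := by
  have hle : closedPast 𝕜 z t ≤ (𝕜 ∙ w)ᗮ := closedPast_le (Submodule.isClosed_orthogonal _)
    fun s hs i => Submodule.mem_orthogonal_singleton_iff_inner_right.2 (h s hs i)
  exact Submodule.mem_orthogonal_singleton_iff_inner_right.1 (hle hv)

end ClosedPast

section IsInnovation

variable {𝕜 E ι κ : Type*} [RCLike 𝕜] [NormedAddCommGroup E] [InnerProductSpace 𝕜 E]
  {z e : ℤ → ι → E} {z' e' : ℤ → κ → E}

variable (𝕜) in
/-- `e` is the innovation process of `z`: `z t i - e t i` is the orthogonal projection of `z t i`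
onto the past of `z` before time `t`. -/
structure IsInnovation (z e : ℤ → ι → E) : Prop where
  sub_mem : ∀ t i, z t i - e t i ∈ closedPast 𝕜 z (t - 1)
  mem_orthogonal : ∀ t i, e t i ∈ (closedPast 𝕜 z (t - 1))ᗮ

namespace IsInnovation

theorem inner_eq_zero (h : IsInnovation 𝕜 z e) {t : ℤ} (i : ι) {v : E}
    (hv : v ∈ closedPast 𝕜 z (t - 1)) : inner 𝕜 (e t i) v = 0 :=
  (Submodule.mem_orthogonal' _ _).1 (h.mem_orthogonal t i) v hv

theorem mem (h : IsInnovation 𝕜 z e) (t : ℤ) (i : ι) : e t i ∈ closedPast 𝕜 z t := by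
  simpa using (closedPast 𝕜 z t).sub_mem (mem_closedPast z le_rfl i)
    (closedPast_mono z (by lia) (h.sub_mem t i))

theorem inner_eq_zero_of_ne (h : IsInnovation 𝕜 z e) {s t : ℤ} (hst : s ≠ t) (i j : ι) :
    inner 𝕜 (e s i) (e t j) = 0 := by
  rcases hst.lt_or_gt with hlt | hlt
  · rw [inner_eq_zero_symm]
    exact h.inner_eq_zero j (closedPast_mono z (by lia) (h.mem s i))
  · exact h.inner_eq_zero i (closedPast_mono z (by lia) (h.mem t j))

theorem comp (h : IsInnovation 𝕜 z e) (f : κ → ι)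
    (hf : ∀ t a, z t (f a) - e t (f a) ∈ closedPast 𝕜 (fun s b => z s (f b)) (t - 1)) :
    IsInnovation 𝕜 (fun t a => z t (f a)) fun t a => e t (f a) :=
  ⟨hf, fun t a => Submodule.orthogonal_le (closedPast_comp_le z f _) (h.mem_orthogonal t (f a))⟩

theorem starProjection_eq (h : IsInnovation 𝕜 z e) {t : ℤ} {i : ι} {K : Submodule 𝕜 E}
    [K.HasOrthogonalProjection] (hK : K ≤ closedPast 𝕜 z (t - 1)) (hmem : z t i - e t i ∈ K) :
    K.starProjection (z t i) = z t i - e t i := by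
  refine Submodule.eq_starProjection_of_mem_orthogonal hmem ?_
  simpa using Submodule.orthogonal_le hK (h.mem_orthogonal t i)

theorem inner_eq_inner_innovation (h : IsInnovation 𝕜 z e) (t : ℤ) (i j : ι) :
    inner 𝕜 (z t i) (e t j) = inner 𝕜 (e t i) (e t j) := by
  rw [← sub_eq_zero, ← inner_sub_left, inner_eq_zero_symm]
  exact h.inner_eq_zero j (h.sub_mem t i)

theorem linearIndependent (h : IsInnovation 𝕜 z e) {t : ℤ} (he : LinearIndependent 𝕜 (e t)) :
    LinearIndependent 𝕜 (z t) := by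
  have hmkQ : (closedPast 𝕜 z (t - 1)).mkQ ∘ e t = (closedPast 𝕜 z (t - 1)).mkQ ∘ z t :=
    funext fun i => ((Submodule.Quotient.eq _).2 (h.sub_mem t i)).symm
  refine LinearIndependent.of_comp (closedPast 𝕜 z (t - 1)).mkQ (hmkQ ▸ he.map ?_)
  rw [Submodule.ker_mkQ]
  refine (Submodule.orthogonal_disjoint _).symm.mono_left (Submodule.span_le.2 ?_)
  rintro _ ⟨i, rfl⟩
  exact h.mem_orthogonal t i

theorem mem_closedPast_sub_one [CompleteSpace E] (h : IsInnovation 𝕜 z e) {t : ℤ} {v : E}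
    (hv : v ∈ closedPast 𝕜 z t) (hve : ∀ i, inner 𝕜 v (e t i) = 0) :
    v ∈ closedPast 𝕜 z (t - 1) := by
  set w := (closedPast 𝕜 z (t - 1)).starProjection v with hw
  have hwmem : w ∈ closedPast 𝕜 z (t - 1) := Submodule.starProjection_apply_mem _ _
  have horth : ∀ y ∈ closedPast 𝕜 z (t - 1), inner 𝕜 (v - w) y = 0 := fun y hy =>
    Submodule.starProjection_inner_eq_zero _ _ hy
  have hself : inner 𝕜 (v - w) (v - w) = 0 := by
    refine inner_eq_zero_of_mem_closedPast (z := z) (t := t) (fun s hs i => ?_)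
      (Submodule.sub_mem _ hv (closedPast_mono z (by lia) hwmem))
    rcases hs.lt_or_eq with hlt | rfl
    · exact horth _ (mem_closedPast z (by lia) i)
    · have he : inner 𝕜 (v - w) (e s i) = 0 := by
        rw [inner_sub_left, hve, inner_eq_zero_symm.1 (h.inner_eq_zero i hwmem), sub_zero]
      rw [← sub_add_cancel (z s i) (e s i), inner_add_right, horth _ (h.sub_mem s i), he, add_zero]
  rwa [sub_eq_zero.1 (inner_self_eq_zero.1 hself)]

theorem eq_zero_of_mem_closedPast [CompleteSpace E] (h : IsInnovation 𝕜 z e)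
    (hz : ⨅ t, closedPast 𝕜 z t = ⊥) {t : ℤ} {v : E} (hv : v ∈ closedPast 𝕜 z t)
    (hve : ∀ s ≤ t, ∀ i, inner 𝕜 v (e s i) = 0) : v = 0 := by
  have hmem : ∀ n : ℕ, v ∈ closedPast 𝕜 z (t - n) := by
    intro n
    induction n with
    | zero => simpa using hv
    | succ n ih =>
      have := h.mem_closedPast_sub_one ih (hve _ (by lia))
      rwa [sub_sub] at this
  rw [← Submodule.mem_bot 𝕜, ← hz, Submodule.mem_iInf]
  exact fun s => closedPast_mono z (by lia) (hmem (t - s).toNat)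

/-- The **Wold decomposition** without deterministic part: what the innovations miss is pushed into
the remote past, which is trivial. -/
theorem closedPast_eq [CompleteSpace E] (h : IsInnovation 𝕜 z e)
    (hz : ⨅ t, closedPast 𝕜 z t = ⊥) (t : ℤ) : closedPast 𝕜 e t = closedPast 𝕜 z t := by
  have hle : closedPast 𝕜 e t ≤ closedPast 𝕜 z t := closedPast_le (isClosed_closedPast _ _)
    fun s hs i => closedPast_mono z hs (h.mem s i)
  refine hle.antisymm fun v hv => ?_
  have hvp : v - (closedPast 𝕜 e t).starProjection v = 0 :=
    h.eq_zero_of_mem_closedPast hz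
      (Submodule.sub_mem _ hv (hle (Submodule.starProjection_apply_mem _ _)))
      fun s hs i => Submodule.starProjection_inner_eq_zero _ _ (mem_closedPast e hs i)
  rw [sub_eq_zero.1 hvp]
  exact Submodule.starProjection_apply_mem _ _

theorem inner_eq_zero_of_inner_innovation_eq_zero [CompleteSpace E] (h : IsInnovation 𝕜 z e)
    (h' : IsInnovation 𝕜 z' e') (hz : ⨅ t, closedPast 𝕜 z t = ⊥)
    (hz' : ⨅ t, closedPast 𝕜 z' t = ⊥) (hee' : ∀ s t i j, inner 𝕜 (e s i) (e' t j) = 0)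
    (s t : ℤ) (i : ι) (j : κ) : inner 𝕜 (z s i) (z' t j) = 0 := by
  refine inner_eq_zero_of_mem_closedPast (z := e') (t := t) (fun r _ l => ?_)
    (h'.closedPast_eq hz' t ▸ mem_closedPast z' le_rfl j)
  rw [inner_eq_zero_symm]
  refine inner_eq_zero_of_mem_closedPast (z := e) (t := s) (fun q _ m => ?_)
    (h.closedPast_eq hz s ▸ mem_closedPast z le_rfl i)
  rw [inner_eq_zero_symm, hee']

theorem of_causal (hmem : ∀ t i, z t i - e t i ∈ closedPast 𝕜 z (t - 1))
    (hcausal : ∀ t i, z t i ∈ closedPast 𝕜 e t)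
    (hwhite : ∀ s t, s ≠ t → ∀ i j, inner 𝕜 (e s i) (e t j) = 0) : IsInnovation 𝕜 z e := by
  refine ⟨hmem, fun t i => (Submodule.mem_orthogonal' _ _).2 fun v hv => ?_⟩
  exact inner_eq_zero_of_mem_closedPast (fun s hs j => inner_eq_zero_of_mem_closedPast
    (fun r hr l => hwhite t r (by lia) i l) (hcausal s j)) hv

theorem iInf_closedPast_eq_bot (h : IsInnovation 𝕜 z e)
    (hcausal : ∀ t i, z t i ∈ closedPast 𝕜 e t) : ⨅ t, closedPast 𝕜 z t = ⊥ := by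
  refine (Submodule.eq_bot_iff _).2 fun v hv => ?_
  rw [Submodule.mem_iInf] at hv
  have hvz : ∀ t i, inner 𝕜 v (z t i) = 0 := fun t i => inner_eq_zero_of_mem_closedPast
    (fun s _ j => inner_eq_zero_symm.1 (h.inner_eq_zero j (hv (s - 1)))) (hcausal t i)
  exact inner_self_eq_zero.1 (inner_eq_zero_of_mem_closedPast (fun s _ i => hvz s i) (hv 0))

end IsInnovation

end IsInnovation

section WeaklyStationary

variable {𝕜 E ι κ : Type*} [RCLike 𝕜] [NormedAddCommGroup E] [InnerProductSpace 𝕜 E]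

variable (𝕜) in
/-- Weak (second-order) stationarity: the second moments `⟪z s i, z t j⟫` are invariant under time
shifts. -/
def IsWeaklyStationary (z : ℤ → ι → E) : Prop :=
  ∀ h s t i j, inner 𝕜 (z (s + h) i) (z (t + h) j) = inner 𝕜 (z s i) (z t j)

variable [Fintype ι] {C : ℕ → Matrix κ ι 𝕜} {e : ℤ → ι → E} {M : ℝ}

/-- The one-sided (causal) moving average `∑ n, C n * e (t - n)` of a vector process `e`. -/
noncomputable def movingAverage (C : ℕ → Matrix κ ι 𝕜) (e : ℤ → ι → E) (t : ℤ) (i : κ) : E :=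
  ∑' n : ℕ, ∑ l, C n i l • e (t - n) l

theorem summable_movingAverage [CompleteSpace E] (hC : Summable C) (he : ∀ t l, ‖e t l‖ ≤ M)
    (t : ℤ) (i : κ) : Summable fun n : ℕ => ∑ l, C n i l • e (t - n) l := by
  refine summable_sum fun l _ => Summable.of_norm_bounded
    ((Pi.summable.1 (Pi.summable.1 hC i) l).norm.mul_right M) fun n => ?_
  rw [norm_smul]
  exact mul_le_mul_of_nonneg_left (he _ l) (norm_nonneg _)

theorem movingAverage_mem_closedPast (C : ℕ → Matrix κ ι 𝕜) (e : ℤ → ι → E) (t : ℤ) (i : κ) :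
    movingAverage C e t i ∈ closedPast 𝕜 e t :=
  tsum_mem (isClosed_closedPast e t) fun n =>
    Submodule.sum_mem _ fun l _ => Submodule.smul_mem _ _ (mem_closedPast e (by lia) l)

theorem inner_movingAverage_right [CompleteSpace E] (hC : Summable C) (he : ∀ t l, ‖e t l‖ ≤ M)
    (v : E) (t : ℤ) (i : κ) : inner 𝕜 v (movingAverage C e t i) =
      ∑' n : ℕ, ∑ l, C n i l * inner 𝕜 v (e (t - n) l) := by
  have := (innerSL 𝕜 v).map_tsum (summable_movingAverage hC he t i)
  simpa [movingAverage, inner_sum, inner_smul_right] using this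

theorem isWeaklyStationary_movingAverage [CompleteSpace E] (h : IsWeaklyStationary 𝕜 e)
    (hC : Summable C) (he : ∀ t l, ‖e t l‖ ≤ M) : IsWeaklyStationary 𝕜 (movingAverage C e) := by
  have hleft : ∀ r s t i l, inner 𝕜 (movingAverage C e (s + r) i) (e (t + r) l) =
      inner 𝕜 (movingAverage C e s i) (e t l) := fun r s t i l => by
    rw [← inner_conj_symm, inner_movingAverage_right hC he,
      ← inner_conj_symm (movingAverage C e s i), inner_movingAverage_right hC he]
    simp only [add_sub_right_comm s r, h r]
  intro r s t i j
  rw [inner_movingAverage_right hC he, inner_movingAverage_right hC he]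
  simp only [add_sub_right_comm t r, hleft]

theorem movingAverage_pow [DecidableEq ι] [CompleteSpace E] {Ψ : Matrix ι ι 𝕜}
    (hΨ : Summable fun n : ℕ => Ψ ^ n) (he : ∀ t l, ‖e t l‖ ≤ M) (t : ℤ) (i : ι) :
    movingAverage (fun n => Ψ ^ n) e t i =
      (∑ l, Ψ i l • movingAverage (fun n => Ψ ^ n) e (t - 1) l) + e t i := by
  have hsum := summable_movingAverage hΨ he
  have hshift : ∀ n : ℕ, ∑ l, (Ψ ^ (n + 1)) i l • e (t - (n + 1 : ℕ)) l =
      ∑ m, Ψ i m • ∑ l, (Ψ ^ n) m l • e (t - 1 - n) l := fun n => by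
    simp only [pow_succ', Matrix.mul_apply, Finset.sum_smul, Finset.smul_sum, smul_smul,
      Nat.cast_add, Nat.cast_one, sub_sub, add_comm (1 : ℤ)]
    exact Finset.sum_comm
  rw [movingAverage, (hsum t i).tsum_eq_zero_add, add_comm]
  congr 1
  · simp only [hshift, movingAverage]
    rw [Summable.tsum_finsetSum fun m _ => (hsum (t - 1) m).const_smul _]
    simp only [(hsum (t - 1) _).tsum_const_smul]
  · simp [Matrix.one_apply]

end WeaklyStationary

section BlockTriangular

variable {𝕜 ι κ : Type*} [RCLike 𝕜] [Fintype ι] [Fintype κ] [DecidableEq ι] [DecidableEq κ]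

theorem fromBlocks_zero₂₁_pow_succ {α : Type*} [Semiring α] (R : Matrix ι ι α) (A : Matrix ι κ α)
    (S : Matrix κ κ α) (n : ℕ) :
    Matrix.fromBlocks R A 0 S ^ (n + 1) = Matrix.fromBlocks (R ^ (n + 1))
      (∑ m ∈ Finset.range (n + 1), R ^ m * A * S ^ (n - m)) 0 (S ^ (n + 1)) := by
  induction n with
  | zero => simp
  | succ n ih =>
    rw [pow_succ', ih, Matrix.fromBlocks_multiply, Finset.sum_range_succ' _ (n + 1)]
    simp [pow_succ', Matrix.mul_sum, Matrix.mul_assoc]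

theorem summable_sum_pow_mul_mul_pow {R : Matrix ι ι 𝕜} {S : Matrix κ κ 𝕜}
    (hR : Summable fun n : ℕ => R ^ n) (hS : Summable fun n : ℕ => S ^ n) (A : Matrix ι κ 𝕜) :
    Summable fun n : ℕ => ∑ m ∈ Finset.range (n + 1), R ^ m * A * S ^ (n - m) := by
  refine Pi.summable.2 fun i => Pi.summable.2 fun j => ?_
  have hentry : ∀ n : ℕ, (∑ m ∈ Finset.range (n + 1), R ^ m * A * S ^ (n - m)) i j =
      ∑ b, ∑ a, A a b * ∑ m ∈ Finset.range (n + 1), (R ^ m) i a * (S ^ (n - m)) b j := fun n => by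
    simp only [Matrix.sum_apply, Matrix.mul_apply, Finset.sum_mul, Finset.mul_sum]
    rw [Finset.sum_comm]
    refine Finset.sum_congr rfl fun b _ => ?_
    rw [Finset.sum_comm]
    exact Finset.sum_congr rfl fun a _ => Finset.sum_congr rfl fun m _ => by ring
  simp only [hentry]
  refine summable_sum fun b _ => summable_sum fun a _ => Summable.mul_left _ ?_
  exact (summable_norm_sum_mul_range_of_summable_norm
    (Pi.summable.1 (Pi.summable.1 hR i) a).norm (Pi.summable.1 (Pi.summable.1 hS b) j).norm).of_norm

theorem summable_fromBlocks_zero₂₁_pow {R : Matrix ι ι 𝕜} {S : Matrix κ κ 𝕜}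
    (hR : Summable fun n : ℕ => R ^ n) (hS : Summable fun n : ℕ => S ^ n) (A : Matrix ι κ 𝕜) :
    Summable fun n : ℕ => Matrix.fromBlocks R A 0 S ^ n := by
  have hA := summable_sum_pow_mul_mul_pow hR hS A
  rw [← summable_nat_add_iff 1] at hR hS ⊢
  simp only [fromBlocks_zero₂₁_pow_succ]
  refine Pi.summable.2 fun i => Pi.summable.2 fun j => ?_
  rcases i with i | i <;> rcases j with j | j
  · exact Pi.summable.1 (Pi.summable.1 hR i) j
  · exact Pi.summable.1 (Pi.summable.1 hA i) j
  · exact summable_zero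
  · exact Pi.summable.1 (Pi.summable.1 hS i) j

theorem summable_zero_pow {α : Type*} [Semiring α] [TopologicalSpace α] :
    Summable fun n : ℕ => (0 : α) ^ n :=
  summable_of_ne_finset_zero (s := {0}) fun n hn => zero_pow (by simpa using hn)

theorem summable_smul_one_pow {ρ : 𝕜} (h : ‖ρ‖ < 1) :
    Summable fun n : ℕ => (ρ • (1 : Matrix ι ι 𝕜)) ^ n := by
  simp only [smul_pow, one_pow]
  exact (summable_geometric_of_norm_lt_one h).smul_const _

end BlockTriangular

theorem inner_Lp_eq_integral {Ω : Type*} {m : MeasurableSpace Ω} {P : Measure Ω}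
    (f g : Lp ℝ 2 P) : inner ℝ f g = ∫ ω, f ω * g ω ∂P := by
  rw [L2.inner_def]
  exact integral_congr_ae (ae_of_all _ fun ω => mul_comm (g ω) (f ω))

theorem integral_eq_zero_of_mem_closedPast {Ω T ι : Type*} {m : MeasurableSpace Ω}
    {P : Measure Ω} [IsFiniteMeasure P] [Preorder T] {z : T → ι → Lp ℝ 2 P} {t : T}
    {v : Lp ℝ 2 P} (h : ∀ s ≤ t, ∀ i, ∫ ω, z s i ω ∂P = 0) (hv : v ∈ closedPast ℝ z t) :
    ∫ ω, v ω ∂P = 0 := by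
  have hone : ∀ f : Lp ℝ 2 P, inner ℝ (indicatorConstLp 2 MeasurableSet.univ
      (measure_ne_top P Set.univ) (1 : ℝ)) f = ∫ ω, f ω ∂P := fun f => by
    rw [L2.inner_indicatorConstLp_one, setIntegral_univ]
  rw [← hone]
  exact inner_eq_zero_of_mem_closedPast (fun s hs i => (hone _).trans (h s hs i)) hv

section GaussianNoise

variable {Ω ι : Type*} {m : MeasurableSpace Ω} {P : Measure Ω} {e : ℤ → ι → Lp ℝ 2 P}

variable (e) in
/-- Gaussian white noise with unit variance: all coordinates at all times are independent standard
normal random variables. -/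
structure IsGaussianNoise : Prop where
  hasLaw : ∀ t i, HasLaw (e t i) (gaussianReal 0 1) P
  iIndepFun : iIndepFun (fun (q : ℤ × ι) ω => e q.1 q.2 ω) P

theorem exists_isGaussianNoise (ι : Type) : ∃ (Ω : Type u) (_ : MeasurableSpace Ω) (P : Measure Ω)
    (e : ℤ → ι → Lp ℝ 2 P), IsProbabilityMeasure P ∧ IsGaussianNoise e := by
  obtain ⟨Ω, mΩ, P, X, -, hlaw, hindep, hP⟩ :=
    exists_iid (ULift.{u} (ℤ × ι)) (gaussianReal 0 1)
  have hX : ∀ q, MemLp (X q) 2 P := fun q =>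
    (memLp_map_measure_iff aestronglyMeasurable_id (hlaw q).aemeasurable).1
      ((hlaw q).map_eq ▸ memLp_id_gaussianReal' 2 ENNReal.ofNat_ne_top)
  refine ⟨Ω, mΩ, P, fun t i => (hX ⟨(t, i)⟩).toLp _, hP, fun t i =>
    (hlaw _).congr (MemLp.coeFn_toLp _), ?_⟩
  exact (hindep.precomp ULift.up_injective).congr fun q => (MemLp.coeFn_toLp _).symm

namespace IsGaussianNoise

theorem integral_eq_zero (h : IsGaussianNoise e) (t : ℤ) (i : ι) : ∫ ω, e t i ω ∂P = 0 := by
  rw [(h.hasLaw t i).integral_eq, integral_id_gaussianReal]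

theorem memLp (h : IsGaussianNoise e) (t : ℤ) (i : ι) {p : ENNReal} (hp : p ≠ ⊤) :
    MemLp (e t i) p P :=
  (memLp_map_measure_iff aestronglyMeasurable_id (h.hasLaw t i).aemeasurable).1
    ((h.hasLaw t i).map_eq ▸ memLp_id_gaussianReal' p hp)

theorem inner_eq_ite [DecidableEq ι] (h : IsGaussianNoise e) (s t : ℤ) (i j : ι) :
    inner ℝ (e s i) (e t j) = if s = t ∧ i = j then 1 else 0 := by
  rw [inner_Lp_eq_integral]
  split_ifs with hst
  · obtain ⟨rfl, rfl⟩ := hst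
    have hvar := variance_of_integral_eq_zero (h.hasLaw s i).aemeasurable (h.integral_eq_zero s i)
    rw [(h.hasLaw s i).variance_eq, variance_id_gaussianReal] at hvar
    simpa [pow_two] using hvar.symm
  · have hindep := h.iIndepFun.indepFun (i := (s, i)) (j := (t, j)) (by simpa using hst)
    rw [hindep.integral_fun_mul_eq_mul_integral (h.hasLaw s i).aemeasurable.aestronglyMeasurable
      (h.hasLaw t j).aemeasurable.aestronglyMeasurable, h.integral_eq_zero, zero_mul]

theorem norm_eq_one (h : IsGaussianNoise e) (t : ℤ) (i : ι) : ‖e t i‖ = 1 := by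
  classical
  rw [norm_eq_sqrt_real_inner, h.inner_eq_ite, if_pos ⟨rfl, rfl⟩, Real.sqrt_one]

theorem gram_eq_one [DecidableEq ι] (h : IsGaussianNoise e) (t : ℤ) :
    Matrix.gram ℝ (e t) = 1 := by
  ext i j
  simp [h.inner_eq_ite, Matrix.one_apply]

theorem isWeaklyStationary (h : IsGaussianNoise e) : IsWeaklyStationary ℝ e := by
  classical
  intro r s t i j
  simp only [h.inner_eq_ite, add_left_inj]

theorem isInnovation_movingAverage_pow [Fintype ι] [DecidableEq ι] (h : IsGaussianNoise e)
    {Ψ : Matrix ι ι ℝ} (hΨ : Summable fun n : ℕ => Ψ ^ n) :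
    IsInnovation ℝ (movingAverage (fun n => Ψ ^ n) e) e := by
  refine .of_causal (fun t i => ?_) (movingAverage_mem_closedPast _ e) fun s t hst i j => ?_
  · rw [movingAverage_pow hΨ (fun t l => (h.norm_eq_one t l).le), add_sub_cancel_right]
    exact Submodule.sum_mem _ fun l _ => Submodule.smul_mem _ _ (mem_closedPast _ le_rfl l)
  · rw [h.inner_eq_ite, if_neg fun hst' => hst hst'.1]

end IsGaussianNoise

end GaussianNoise

namespace DGP

section Moments

variable {k N : ℕ} (D : DGP.{u} k N)

theorem coeFn_zbar (t : ℤ) (i : Fin k ⊕ Fin N) : D.zbar t i =ᵐ[D.P] D.zc t i :=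
  MemLp.coeFn_toLp _

theorem integral_zc (t : ℤ) (i : Fin k ⊕ Fin N) : ∫ ω, D.zc t i ω ∂D.P = 0 := by
  cases i with
  | inl i =>
    simp only [zc]
    rw [integral_sub ((D.memLp_x t i).integrable one_le_two) (integrable_const _), D.mean_x]
    simp
  | inr i => exact D.mean_u t i

theorem integral_zbar (t : ℤ) (i : Fin k ⊕ Fin N) : ∫ ω, D.zbar t i ω ∂D.P = 0 := by
  rw [integral_congr_ae (D.coeFn_zbar t i), integral_zc]

theorem covariance_zc (s t : ℤ) (i j : Fin k ⊕ Fin N) :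
    cov[D.zc s i, D.zc t j; D.P] = inner ℝ (D.zbar s i) (D.zbar t j) := by
  rw [inner_Lp_eq_integral, covariance, integral_zc, integral_zc]
  refine integral_congr_ae ?_
  filter_upwards [D.coeFn_zbar s i, D.coeFn_zbar t j] with ω hs ht
  rw [hs, ht, sub_zero, sub_zero]

theorem integral_x_mul (s : ℤ) (j : Fin k) {v : Lp ℝ 2 D.P} (hv : ∫ ω, v ω ∂D.P = 0) :
    ∫ ω, D.x s j ω * v ω ∂D.P = inner ℝ (D.zbar s (Sum.inl j)) v := by
  have hx : ∫ ω, (D.x s j ω - D.μx j) * v ω ∂D.P = inner ℝ (D.zbar s (Sum.inl j)) v := by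
    rw [inner_Lp_eq_integral]
    refine integral_congr_ae ?_
    filter_upwards [D.coeFn_zbar s (Sum.inl j)] with ω h
    rw [h, zc]
  have hint : Integrable (fun ω => D.x s j ω * v ω) D.P :=
    (D.memLp_x s j).integrable_mul (Lp.memLp v)
  simp only [← hx, sub_mul]
  rw [integral_sub hint (((Lp.memLp v).integrable one_le_two).const_mul _), integral_const_mul,
    hv, mul_zero, sub_zero]

theorem integral_u_mul_x (t s : ℤ) (i : Fin N) (j : Fin k) :
    ∫ ω, D.u t i ω * D.x s j ω ∂D.P =
      inner ℝ (D.zbar t (Sum.inr i)) (D.zbar s (Sum.inl j)) := by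
  rw [real_inner_comm, ← D.integral_x_mul s j (D.integral_zbar t _)]
  refine integral_congr_ae ?_
  filter_upwards [D.coeFn_zbar t (Sum.inr i)] with ω h
  rw [h, zc, mul_comm]

theorem isWeaklyStationary_zbar_iff : IsWeaklyStationary ℝ D.zbar ↔ ∀ t h i j,
    cov[D.zc (t + h) i, D.zc t j; D.P] = cov[D.zc h i, D.zc 0 j; D.P] := by
  simp only [covariance_zc]
  refine ⟨fun hz t h i j => ?_, fun hz h s t i j => ?_⟩
  · simpa [add_comm t h] using hz t h 0 i j
  · have hdiff : ∀ s t, inner ℝ (D.zbar s i) (D.zbar t j) =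
        inner ℝ (D.zbar (s - t) i) (D.zbar 0 j) := fun s t => by
      simpa using hz t (s - t) i j
    rw [hdiff, hdiff s t, add_sub_add_right_eq_sub]

theorem isInnovation_innov : IsInnovation ℝ D.zbar D.innov where
  sub_mem t i := by
    rw [innov, sub_sub_cancel]
    exact Submodule.starProjection_apply_mem _ _
  mem_orthogonal t i := Submodule.sub_starProjection_mem_orthogonal _

theorem integral_innov (t : ℤ) (i : Fin k ⊕ Fin N) : ∫ ω, D.innov t i ω ∂D.P = 0 :=
  integral_eq_zero_of_mem_closedPast (fun s _ => D.integral_zbar s) (D.isInnovation_innov.mem t i)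

theorem innovCov_eq_gram (t : ℤ) : D.innovCov t = Matrix.gram ℝ (D.innov t) :=
  Matrix.ext fun _ _ => (inner_Lp_eq_integral _ _).symm

theorem inner_zbar_innov (t : ℤ) (i j : Fin k ⊕ Fin N) :
    inner ℝ (D.zbar t i) (D.innov t j) = D.innovCov t i j := by
  rw [D.isInnovation_innov.inner_eq_inner_innovation, innovCov_eq_gram, Matrix.gram_apply]

theorem linearIndependent_zbar {t : ℤ} (h : (D.innovCov t).PosDef) :
    LinearIndependent ℝ (D.zbar t) :=
  D.isInnovation_innov.linearIndependent
    (Matrix.linearIndependent_of_posDef_gram (D.innovCov_eq_gram t ▸ h))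

theorem preDetermined_iff_sigmaXUZero : D.PreDetermined ↔ D.SigmaXUZero := by
  simp only [PreDetermined, D.integral_x_mul _ _ (D.integral_innov _ _)]
  refine ⟨fun h t => Matrix.ext fun j i => ?_, fun h t n j i => ?_⟩
  · rw [Matrix.toBlocks₁₂, Matrix.of_apply, ← inner_zbar_innov]
    simpa using h t 0 j i
  · obtain rfl | hn := n.eq_zero_or_pos
    · rw [Nat.cast_zero, add_zero, inner_zbar_innov]
      exact congr_fun₂ (h t) j i
    · rw [real_inner_comm]
      exact D.isInnovation_innov.inner_eq_zero _ (mem_closedPast _ (by lia) _)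

theorem toBlocks₂₁_innovCov (t : ℤ) :
    (D.innovCov t).toBlocks₂₁ = (D.innovCov t).toBlocks₁₂.transpose := by
  rw [innovCov_eq_gram]
  exact Matrix.ext fun i j => real_inner_comm (D.innov t (Sum.inl j)) (D.innov t (Sum.inr i))

end Moments

section VAR

variable {k N p : ℕ} {D : DGP.{u} k N}
  {Ψ : Fin p → Matrix (Fin k ⊕ Fin N) (Fin k ⊕ Fin N) ℝ}

variable (D Ψ) in
/-- The linear predictor `∑ j, Ψ_j z̄ (t-j)` of `z̄ t` from the last `p` observations; as in
`IsVAR`, `Ψ j` is the coefficient of lag `j + 1`. -/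
noncomputable def predictor (t : ℤ) (i : Fin k ⊕ Fin N) : Lp ℝ 2 D.P :=
  ∑ j : Fin p, ∑ l, Ψ j i l • D.zbar (t - ((j : ℤ) + 1)) l

theorem isVAR_iff_predictor : D.IsVAR p Ψ ↔ ∀ t i, D.zbar t i - D.predictor Ψ t i = D.innov t i :=
  forall₂_congr fun _ _ => sub_eq_iff_eq_add'.symm

theorem inner_predictor (t : ℤ) (i : Fin k ⊕ Fin N) (v : Lp ℝ 2 D.P) :
    inner ℝ (D.predictor Ψ t i) v =
      ∑ j : Fin p, ∑ l, Ψ j i l * inner ℝ (D.zbar (t - ((j : ℤ) + 1)) l) v := by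
  simp only [predictor, sum_inner, real_inner_smul_left]

theorem zbar_mem_finitePast (t : ℤ) (j : Fin p) (l : Fin k ⊕ Fin N) :
    D.zbar (t - ((j : ℤ) + 1)) l ∈ D.finitePast p t :=
  Submodule.subset_span ⟨(j, l), rfl⟩

theorem finitePast_le_closedPast (t : ℤ) : D.finitePast p t ≤ closedPast ℝ D.zbar (t - 1) := by
  refine Submodule.span_le.2 ?_
  rintro _ ⟨⟨j, l⟩, rfl⟩
  exact mem_closedPast D.zbar (by lia) l

theorem predictor_mem_finitePast (t : ℤ) (i : Fin k ⊕ Fin N) :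
    D.predictor Ψ t i ∈ D.finitePast p t :=
  Submodule.sum_mem _ fun j _ => Submodule.sum_mem _ fun l _ =>
    Submodule.smul_mem _ _ (zbar_mem_finitePast t j l)

theorem predictor_mem_closedPast_comp {κ : Type*} (f : κ → Fin k ⊕ Fin N) {i : Fin k ⊕ Fin N}
    (hf : ∀ j, ∀ l ∉ Set.range f, Ψ j i l = 0) (t : ℤ) :
    D.predictor Ψ t i ∈ closedPast ℝ (fun s a => D.zbar s (f a)) (t - 1) := by
  refine Submodule.sum_mem _ fun j _ => Submodule.sum_mem _ fun l _ => ?_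
  by_cases hl : l ∈ Set.range f
  · obtain ⟨a, rfl⟩ := hl
    exact Submodule.smul_mem _ _ (mem_closedPast (fun s a => D.zbar s (f a)) (by lia) a)
  · rw [hf j l hl, zero_smul]
    exact Submodule.zero_mem _

theorem inner_zbar_sub_predictor_add (hz : IsWeaklyStationary ℝ D.zbar) (h t s : ℤ)
    (i l : Fin k ⊕ Fin N) :
    inner ℝ (D.zbar (t + h) i - D.predictor Ψ (t + h) i) (D.zbar (s + h) l) =
      inner ℝ (D.zbar t i - D.predictor Ψ t i) (D.zbar s l) := by
  simp only [inner_sub_left, inner_predictor, add_sub_right_comm t h, hz h]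

namespace FinitePredictorExact

theorem isWeaklyStationary (hD : D.FinitePredictorExact p) : IsWeaklyStationary ℝ D.zbar :=
  D.isWeaklyStationary_zbar_iff.2 hD.stationary

theorem isVAR_iff_forall_inner_eq_zero (hD : D.FinitePredictorExact p) :
    D.IsVAR p Ψ ↔ ∀ t i (j : Fin p) l,
      inner ℝ (D.zbar t i - D.predictor Ψ t i) (D.zbar (t - ((j : ℤ) + 1)) l) = 0 := by
  rw [isVAR_iff_predictor]
  refine ⟨fun h t i j l => ?_, fun h t i => ?_⟩
  · rw [h]
    exact D.isInnovation_innov.inner_eq_zero i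
      (finitePast_le_closedPast t (zbar_mem_finitePast t j l))
  · rw [innov, hD.exact_predictor, Submodule.eq_starProjection_of_mem_orthogonal
      (predictor_mem_finitePast (Ψ := Ψ) t i)]
    have hle : D.finitePast p t ≤ (ℝ ∙ (D.zbar t i - D.predictor Ψ t i))ᗮ := by
      refine Submodule.span_le.2 ?_
      rintro _ ⟨⟨j, l⟩, rfl⟩
      exact Submodule.mem_orthogonal_singleton_iff_inner_right.2 (h t i j l)
    exact (Submodule.mem_orthogonal' _ _).2 fun v hv =>
      Submodule.mem_orthogonal_singleton_iff_inner_right.1 (hle hv)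

theorem exists_isVAR (hD : D.FinitePredictorExact p) :
    ∃ Ψ : Fin p → Matrix (Fin k ⊕ Fin N) (Fin k ⊕ Fin N) ℝ, D.IsVAR p Ψ := by
  have hproj : ∀ i, ∃ c : Fin p × (Fin k ⊕ Fin N) → ℝ,
      ∑ q, c q • D.zbar (0 - ((q.1 : ℤ) + 1)) q.2 =
        (D.finitePast p 0).starProjection (D.zbar 0 i) := fun i => by
    have := Submodule.starProjection_apply_mem (D.finitePast p 0) (D.zbar 0 i)
    exact (Submodule.mem_span_range_iff_exists_fun ℝ).1 this
  choose c hc using hproj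
  refine ⟨fun j => Matrix.of fun i l => c i (j, l),
    hD.isVAR_iff_forall_inner_eq_zero.2 fun t i j l => ?_⟩
  have hpred : D.predictor (fun j => Matrix.of fun i l => c i (j, l)) 0 i =
      (D.finitePast p 0).starProjection (D.zbar 0 i) := by
    rw [← hc, Fintype.sum_prod_type]
    rfl
  have hshift := inner_zbar_sub_predictor_add (Ψ := fun j => Matrix.of fun i l => c i (j, l))
    hD.isWeaklyStationary t 0 (0 - ((j : ℤ) + 1)) i l
  rw [zero_add, zero_sub, neg_add_eq_sub] at hshift
  rw [hshift, hpred]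
  refine Submodule.starProjection_inner_eq_zero _ _ ?_
  simpa using zbar_mem_finitePast (D := D) 0 j l

theorem ebd_iff_sigmaXUZero (hD : D.FinitePredictorExact p) : D.EBD p ↔ D.SigmaXUZero :=
  ⟨fun h t => (h.2 t).1, fun h => ⟨hD.exists_isVAR, fun t =>
    ⟨h t, by rw [toBlocks₂₁_innovCov, h t, Matrix.transpose_zero]⟩⟩⟩

end FinitePredictorExact

end VAR

section StrictExogeneity

variable {k N p : ℕ} {D : DGP.{u} k N}
  {Ψ : Fin p → Matrix (Fin k ⊕ Fin N) (Fin k ⊕ Fin N) ℝ}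

theorem toBlocks_eq_zero_iff {α ι κ : Type*} [Zero α] {M : Matrix (ι ⊕ κ) (ι ⊕ κ) α} :
    M.toBlocks₁₂ = 0 ∧ M.toBlocks₂₁ = 0 ↔ ∀ i j, i.isLeft ≠ j.isLeft → M i j = 0 := by
  simp [← Matrix.ext_iff, Matrix.toBlocks₁₂, Matrix.toBlocks₂₁]

theorem strictlyExogenous_iff_inner_eq_zero : D.StrictlyExogenous ↔
    ∀ s t i j, i.isLeft ≠ j.isLeft → inner ℝ (D.zbar s i) (D.zbar t j) = 0 := by
  simp only [StrictlyExogenous, integral_u_mul_x]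
  refine ⟨fun h s t i j hij => ?_, fun h t s i j => h t s _ _ (by simp)⟩
  rcases i with i | i <;> rcases j with j | j
  · simp at hij
  · rw [real_inner_comm, h]
  · exact h s t i j
  · simp at hij

theorem BD.ebd (h : D.BD p) : D.EBD p :=
  ⟨h.1.imp fun _ hΨ => hΨ.1, h.2⟩

theorem inner_predictor_eq_zero_of_isLeft_ne (hΨ : ∀ a i l, i.isLeft ≠ l.isLeft → Ψ a i l = 0)
    (hz : ∀ s t i j, i.isLeft ≠ j.isLeft → inner ℝ (D.zbar s i) (D.zbar t j) = 0) (s t : ℤ)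
    {i j : Fin k ⊕ Fin N} (hij : i.isLeft ≠ j.isLeft) :
    inner ℝ (D.predictor Ψ t i) (D.zbar s j) = 0 := by
  rw [inner_predictor]
  refine Finset.sum_eq_zero fun a _ => Finset.sum_eq_zero fun l _ => ?_
  by_cases hl : i.isLeft = l.isLeft
  · rw [hz _ _ l j (hl ▸ hij), mul_zero]
  · rw [hΨ a i l hl, zero_mul]

theorem inner_predictor_congr {Φ : Fin p → Matrix (Fin k ⊕ Fin N) (Fin k ⊕ Fin N) ℝ}
    (hΨΦ : ∀ a i l, i.isLeft = l.isLeft → Ψ a i l = Φ a i l)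
    (hz : ∀ s t i j, i.isLeft ≠ j.isLeft → inner ℝ (D.zbar s i) (D.zbar t j) = 0) (s t : ℤ)
    {i j : Fin k ⊕ Fin N} (hij : i.isLeft = j.isLeft) :
    inner ℝ (D.predictor Ψ t i) (D.zbar s j) = inner ℝ (D.predictor Φ t i) (D.zbar s j) := by
  rw [inner_predictor, inner_predictor]
  refine Finset.sum_congr rfl fun a _ => Finset.sum_congr rfl fun l _ => ?_
  by_cases hl : i.isLeft = l.isLeft
  · rw [hΨΦ a i l hl]
  · rw [hz _ _ l j fun h => hl (hij.trans h.symm), mul_zero, mul_zero]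

namespace FinitePredictorExact

theorem bd_of_strictlyExogenous (hD : D.FinitePredictorExact p) (h : D.StrictlyExogenous) :
    D.BD p := by
  have hz := strictlyExogenous_iff_inner_eq_zero.1 h
  obtain ⟨Φ, hΦ⟩ := hD.exists_isVAR
  let Ψ : Fin p → Matrix (Fin k ⊕ Fin N) (Fin k ⊕ Fin N) ℝ := fun a =>
    Matrix.of fun i l => if i.isLeft = l.isLeft then Φ a i l else 0
  have hΨ : ∀ a i l, i.isLeft ≠ l.isLeft → Ψ a i l = 0 := fun a i l hil => if_neg hil
  have hΨΦ : ∀ a i l, i.isLeft = l.isLeft → Ψ a i l = Φ a i l := fun a i l hil => if_pos hil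
  have hVAR : D.IsVAR p Ψ := hD.isVAR_iff_forall_inner_eq_zero.2 fun t i a l => by
    rw [inner_sub_left]
    by_cases hil : i.isLeft = l.isLeft
    · rw [inner_predictor_congr hΨΦ hz _ _ hil, ← inner_sub_left]
      exact hD.isVAR_iff_forall_inner_eq_zero.1 hΦ t i a l
    · rw [hz _ _ _ _ hil, inner_predictor_eq_zero_of_isLeft_ne hΨ hz _ _ hil, sub_zero]
  refine ⟨⟨Ψ, hVAR, fun a => toBlocks_eq_zero_iff.2 (hΨ a)⟩, fun t =>
    toBlocks_eq_zero_iff.2 fun i j hij => ?_⟩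
  rw [← inner_zbar_innov, ← isVAR_iff_predictor.1 hVAR, inner_sub_right, hz _ _ _ _ hij,
    real_inner_comm, inner_predictor_eq_zero_of_isLeft_ne hΨ hz _ _ hij.symm, sub_zero]

theorem strictlyExogenous_of_bd (hD : D.FinitePredictorExact p) (h : D.BD p) :
    D.StrictlyExogenous := by
  obtain ⟨⟨Ψ, hVAR, hΨ⟩, hcov⟩ := h
  simp only [toBlocks_eq_zero_iff] at hΨ hcov
  have hblock : ∀ {κ : Type} (f : κ → Fin k ⊕ Fin N),
      (∀ a, ∀ l ∉ Set.range f, (f a).isLeft ≠ l.isLeft) →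
      IsInnovation ℝ (fun t a => D.zbar t (f a)) (fun t a => D.innov t (f a)) ∧
        ⨅ t, closedPast ℝ (fun s a => D.zbar s (f a)) t = ⊥ := fun f hf => by
    refine ⟨D.isInnovation_innov.comp f fun t a => ?_,
      le_bot_iff.1 (hD.nondeterministic ▸ iInf_mono fun t => closedPast_comp_le D.zbar f t)⟩
    rw [← isVAR_iff_predictor.1 hVAR, sub_sub_cancel]
    exact predictor_mem_closedPast_comp f (fun j l hl => hΨ j _ _ (hf a l hl)) t
  obtain ⟨hx, hx_bot⟩ := hblock (Sum.inl : Fin k → _) (by simp)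
  obtain ⟨hu, hu_bot⟩ := hblock (Sum.inr : Fin N → _) (by simp)
  intro t s i j
  rw [integral_u_mul_x]
  refine hu.inner_eq_zero_of_inner_innovation_eq_zero hx hu_bot hx_bot (fun s t i j => ?_) t s i j
  obtain rfl | hst := eq_or_ne s t
  · rw [← D.isInnovation_innov.inner_eq_inner_innovation, inner_zbar_innov]
    exact hcov s _ _ (by simp)
  · exact D.isInnovation_innov.inner_eq_zero_of_ne hst _ _

theorem strictlyExogenous_iff_bd (hD : D.FinitePredictorExact p) :
    D.StrictlyExogenous ↔ D.BD p :=
  ⟨hD.bd_of_strictlyExogenous, hD.strictlyExogenous_of_bd⟩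

end FinitePredictorExact

end StrictExogeneity

section TriangularVAR

variable {k N : ℕ} {D : DGP.{u} k N} {R : Matrix (Fin k) (Fin k) ℝ} {A : Matrix (Fin k) (Fin N) ℝ}
  {S : Matrix (Fin N) (Fin N) ℝ}

theorem zbar_inl_of_isVAR (h : D.IsVAR 1 fun _ => Matrix.fromBlocks R A 0 S) (t : ℤ) (i : Fin k) :
    D.zbar t (Sum.inl i) = ∑ l, R i l • D.zbar (t - 1) (Sum.inl l) +
      ∑ l, A i l • D.zbar (t - 1) (Sum.inr l) + D.innov t (Sum.inl i) := by
  simpa using h t (Sum.inl i)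

theorem zbar_inr_of_isVAR (h : D.IsVAR 1 fun _ => Matrix.fromBlocks R A 0 S) (t : ℤ) (i : Fin N) :
    D.zbar t (Sum.inr i) =
      ∑ l, S i l • D.zbar (t - 1) (Sum.inr l) + D.innov t (Sum.inr i) := by
  simpa using h t (Sum.inr i)

theorem presentPastExogenous_of_isVAR (h : D.IsVAR 1 fun _ => Matrix.fromBlocks R A 0 0)
    (hD : D.PreDetermined) : D.PresentPastExogenous := by
  intro t s hst i j
  have hux := hD s (t - s).toNat j i
  rw [Int.toNat_of_nonneg (sub_nonneg.2 hst), add_sub_cancel,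
    D.integral_x_mul _ _ (D.integral_innov _ _)] at hux
  rw [integral_u_mul_x, real_inner_comm, zbar_inr_of_isVAR h]
  simpa using hux

theorem eq_zero_of_isVAR_of_inner_eq_zero (h : D.IsVAR 1 fun _ => Matrix.fromBlocks R A 0 S)
    (hD : D.PresentPastExogenous) {t : ℤ} (hpos : (D.innovCov (t - 1)).PosDef)
    (hxu : ∀ i j, inner ℝ (D.zbar t (Sum.inl i)) (D.zbar (t - 1) (Sum.inr j)) = 0) : A = 0 := by
  ext i l
  set w := ∑ l, A i l • D.zbar (t - 1) (Sum.inr l) with hw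
  have hwu : ∀ j, inner ℝ w (D.zbar (t - 1) (Sum.inr j)) = 0 := fun j => by
    have hx : ∀ l, inner ℝ (D.zbar (t - 1) (Sum.inl l)) (D.zbar (t - 1) (Sum.inr j)) = 0 :=
      fun l => by rw [real_inner_comm, ← integral_u_mul_x, hD _ _ le_rfl]
    have he : inner ℝ (D.innov t (Sum.inl i)) (D.zbar (t - 1) (Sum.inr j)) = 0 :=
      D.isInnovation_innov.inner_eq_zero _ (mem_closedPast _ le_rfl _)
    have hsum := hxu i j
    rw [zbar_inl_of_isVAR h, ← hw] at hsum
    simpa [inner_add_left, sum_inner, inner_smul_left, hx, he] using hsum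
  have hw0 : inner ℝ w w = 0 := by
    nth_rewrite 2 [hw]
    simp [inner_sum, inner_smul_right, hwu]
  exact Fintype.linearIndependent_iff.1
    ((D.linearIndependent_zbar hpos).comp Sum.inr Sum.inr_injective) (A i)
      (inner_self_eq_zero.1 hw0) l

theorem eq_zero_of_isVAR_of_strictlyExogenous
    (h : D.IsVAR 1 fun _ => Matrix.fromBlocks R A 0 S) (hD : D.StrictlyExogenous) {t : ℤ}
    (hpos : (D.innovCov t).PosDef) : A = 0 := by
  refine eq_zero_of_isVAR_of_inner_eq_zero h (fun t s _ => hD t s) (t := t + 1) (by simpa) ?_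
  exact fun i j => strictlyExogenous_iff_inner_eq_zero.1 hD _ _ _ _ (by simp)

theorem eq_zero_of_isVAR_of_presentPastExogenous
    (h : D.IsVAR 1 fun _ => Matrix.fromBlocks R A 0 S) (hS : IsUnit S) (hcov : D.SigmaXUZero)
    (hD : D.PresentPastExogenous) {t : ℤ} (hpos : (D.innovCov t).PosDef) : A = 0 := by
  refine eq_zero_of_isVAR_of_inner_eq_zero h hD (t := t + 1) (by simpa) fun i j => ?_
  have hmul : S.mulVec (fun l => inner ℝ (D.zbar (t + 1) (Sum.inl i))
      (D.zbar (t + 1 - 1) (Sum.inr l))) = 0 := by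
    ext m
    have hxu : inner ℝ (D.zbar (t + 1) (Sum.inl i)) (D.zbar (t + 1) (Sum.inr m)) = 0 := by
      rw [real_inner_comm, ← integral_u_mul_x, hD _ _ le_rfl]
    have he : D.innovCov (t + 1) (Sum.inl i) (Sum.inr m) = 0 := congr_fun₂ (hcov (t + 1)) i m
    rw [zbar_inr_of_isVAR h, inner_add_right, inner_zbar_innov, he, add_zero, inner_sum] at hxu
    simpa [Matrix.mulVec, dotProduct, inner_smul_right] using hxu
  exact congr_fun (Matrix.mulVec_injective_of_isUnit hS (hmul.trans (S.mulVec_zero).symm)) j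

end TriangularVAR

section OfLp

variable {k N : ℕ} {Ω : Type u} [MeasurableSpace Ω] {P : Measure Ω} [IsProbabilityMeasure P]
  {z : ℤ → Fin k ⊕ Fin N → Lp ℝ 2 P}

variable (z) in
/-- The data-generating process with `z̄ = z`, for a centered process `z` in `L²`. -/
noncomputable def ofLp (hz : ∀ t i, ∫ ω, z t i ω ∂P = 0) : DGP.{u} k N where
  Ω := Ω
  mΩ := inferInstance
  P := P
  isProb := inferInstance
  x t i := z t (Sum.inl i)
  u t i := z t (Sum.inr i)
  μx := 0
  memLp_x _ _ := Lp.memLp _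
  memLp_u _ _ := Lp.memLp _
  mean_x t i := hz t (Sum.inl i)
  mean_u t i := hz t (Sum.inr i)

theorem zbar_ofLp (hz : ∀ t i, ∫ ω, z t i ω ∂P = 0) : (ofLp z hz).zbar = z := by
  funext t i
  refine Lp.ext (((ofLp z hz).coeFn_zbar t i).trans (Eq.eventuallyEq ?_))
  cases i with
  | inl i => exact funext fun ω => sub_zero (z t (Sum.inl i) ω)
  | inr i => rfl

end OfLp

section GaussianVAR

variable {k N : ℕ} {D : DGP.{u} k N}

theorem innov_eq_of_isInnovation {e : ℤ → Fin k ⊕ Fin N → Lp ℝ 2 D.P}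
    (h : IsInnovation ℝ D.zbar e) : D.innov = e := by
  funext t i
  rw [innov, h.starProjection_eq (K := D.past (t - 1)) le_rfl (h.sub_mem t i), sub_sub_cancel]

theorem indep_sigmaPast_sigmaFuture (hD : iIndepFun (fun q : ℤ × (Fin k ⊕ Fin N) =>
    D.innov q.1 q.2) D.P) {s t : ℤ} (h : s < t) : Indep (D.sigmaPast s) (D.sigmaFuture t) D.P := by
  let σ : ℤ × (Fin k ⊕ Fin N) → MeasurableSpace D.Ω := fun q =>
    MeasurableSpace.comap (D.innov q.1 q.2) inferInstance
  have hdisj : Disjoint {q : ℤ × (Fin k ⊕ Fin N) | q.1 ≤ s} {q | t ≤ q.1} :=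
    Set.disjoint_left.2 fun q hs ht => (h.trans_le ht).not_ge hs
  have hindep := indep_iSup_of_disjoint (m := σ)
    (fun q => (Lp.stronglyMeasurable (D.innov q.1 q.2)).measurable.comap_le) hD.iIndep hdisj
  have hpast : D.sigmaPast s ≤ ⨆ q ∈ {q : ℤ × (Fin k ⊕ Fin N) | q.1 ≤ s}, σ q :=
    iSup₂_le fun r hr => iSup_le fun i => le_iSup₂ (f := fun q _ => σ q) (r, i) hr
  have hfuture : D.sigmaFuture t ≤ ⨆ q ∈ {q : ℤ × (Fin k ⊕ Fin N) | t ≤ q.1}, σ q :=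
    iSup₂_le fun r hr => iSup_le fun i => le_iSup₂ (f := fun q _ => σ q) (r, i) hr
  exact indep_of_indep_of_le_left (indep_of_indep_of_le_right hindep hfuture) hpast

theorem alphaMix_eq_zero (hD : iIndepFun (fun q : ℤ × (Fin k ⊕ Fin N) => D.innov q.1 q.2) D.P)
    {n : ℕ} (hn : 0 < n) : D.alphaMix n = 0 := by
  have hzero : ∀ r ∈ {r | ∃ (t : ℤ) (A B : Set D.Ω), MeasurableSet[D.sigmaPast (t - n)] A ∧
      MeasurableSet[D.sigmaFuture t] B ∧ r = |D.P.real (A ∩ B) - D.P.real A * D.P.real B|},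
      r = 0 := by
    rintro r ⟨t, A, B, hA, hB, rfl⟩
    have hindep := (Indep_iff _ _ _).1 (indep_sigmaPast_sigmaFuture hD (by lia)) A B hA hB
    rw [measureReal_def, hindep, ENNReal.toReal_mul, ← measureReal_def, ← measureReal_def,
      sub_self, abs_zero]
  exact le_antisymm (Real.sSup_nonpos fun r hr => (hzero r hr).le)
    (Real.sSup_nonneg fun r hr => (hzero r hr).ge)

theorem exact_predictor_of_isVAR {Ψ : Matrix (Fin k ⊕ Fin N) (Fin k ⊕ Fin N) ℝ}
    (h : D.IsVAR 1 fun _ => Ψ) {p : ℕ} (hp : 1 ≤ p) (t : ℤ) (i : Fin k ⊕ Fin N) :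
    (D.past (t - 1)).starProjection (D.zbar t i) =
      (D.finitePast p t).starProjection (D.zbar t i) := by
  have hmem : D.zbar t i - D.innov t i ∈ D.finitePast p t := by
    rw [h t i, add_sub_cancel_right]
    refine Submodule.sum_mem _ fun j _ => Submodule.sum_mem _ fun l _ =>
      Submodule.smul_mem _ _ ?_
    simpa using zbar_mem_finitePast (D := D) t (⟨0, hp⟩ : Fin p) l
  rw [D.isInnovation_innov.starProjection_eq (finitePast_le_closedPast t) hmem,
    D.isInnovation_innov.starProjection_eq (K := D.past (t - 1)) le_rfl
      (D.isInnovation_innov.sub_mem t i)]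

variable {Ψ : Matrix (Fin k ⊕ Fin N) (Fin k ⊕ Fin N) ℝ}

theorem isVAR_of_zbar_eq_movingAverage (hΨ : Summable fun n : ℕ => Ψ ^ n)
    (hnoise : IsGaussianNoise D.innov) (hz : D.zbar = movingAverage (fun n => Ψ ^ n) D.innov) :
    D.IsVAR 1 fun _ => Ψ := fun t i => by
  simpa [hz] using movingAverage_pow hΨ (fun t l => (hnoise.norm_eq_one t l).le) t i

theorem finitePredictorExact_of_zbar_eq_movingAverage (hΨ : Summable fun n : ℕ => Ψ ^ n)
    (hnoise : IsGaussianNoise D.innov) (hz : D.zbar = movingAverage (fun n => Ψ ^ n) D.innov)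
    {p : ℕ} (hp : 1 ≤ p) : D.FinitePredictorExact p where
  one_le := hp
  stationary := D.isWeaklyStationary_zbar_iff.1 <| hz ▸
    isWeaklyStationary_movingAverage hnoise.isWeaklyStationary hΨ
      fun t l => (hnoise.norm_eq_one t l).le
  nondeterministic := D.isInnovation_innov.iInf_closedPast_eq_bot fun t i =>
    hz ▸ movingAverage_mem_closedPast (fun n => Ψ ^ n) D.innov t i
  exact_predictor := exact_predictor_of_isVAR (isVAR_of_zbar_eq_movingAverage hΨ hnoise hz) hp
  mixing_moments := by
    refine ⟨1, one_pos, tendsto_const_nhds.congr' ?_, ?_, fun t =>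
      .of_eval_piLp fun i => hnoise.memLp t i ENNReal.ofReal_ne_top⟩
    · filter_upwards [eventually_gt_atTop 0] with n hn
      exact (alphaMix_eq_zero hnoise.iIndepFun hn).symm
    · simp only [alphaMix_eq_zero hnoise.iIndepFun (Nat.succ_pos _)]
      rw [Real.zero_rpow (by norm_num)]
      exact summable_zero
  posDef t := by
    rw [innovCov_eq_gram, hnoise.gram_eq_one]
    exact Matrix.PosDef.one

theorem exists_zbar_eq_movingAverage (hΨ : Summable fun n : ℕ => Ψ ^ n) : ∃ D : DGP.{u} k N,
    IsGaussianNoise D.innov ∧ D.zbar = movingAverage (fun n => Ψ ^ n) D.innov := by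
  obtain ⟨Ω, mΩ, P, e, hP, he⟩ := exists_isGaussianNoise.{u} (Fin k ⊕ Fin N)
  have hmean : ∀ t i, ∫ ω, movingAverage (fun n => Ψ ^ n) e t i ω ∂P = 0 := fun t i =>
    integral_eq_zero_of_mem_closedPast (fun s _ => he.integral_eq_zero s)
      (movingAverage_mem_closedPast _ e t i)
  have hinnov : (ofLp _ hmean).innov = e := innov_eq_of_isInnovation
    ((zbar_ofLp hmean).symm ▸ he.isInnovation_movingAverage_pow hΨ)
  exact ⟨ofLp _ hmean, hinnov.symm ▸ he,
    (zbar_ofLp hmean).trans (congrArg (movingAverage fun n => Ψ ^ n) hinnov.symm)⟩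

theorem exists_finitePredictorExact_of_summable_pow (hΨ : Summable fun n : ℕ => Ψ ^ n) {p : ℕ}
    (hp : 1 ≤ p) : ∃ D : DGP.{u} k N,
      D.FinitePredictorExact p ∧ D.SigmaXUZero ∧ D.IsVAR 1 fun _ => Ψ := by
  obtain ⟨D, hnoise, hz⟩ := exists_zbar_eq_movingAverage.{u} hΨ
  refine ⟨D, finitePredictorExact_of_zbar_eq_movingAverage hΨ hnoise hz hp, fun t => ?_,
    isVAR_of_zbar_eq_movingAverage hΨ hnoise hz⟩
  rw [innovCov_eq_gram, hnoise.gram_eq_one, ← Matrix.fromBlocks_one,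
    Matrix.toBlocks_fromBlocks₁₂]

end GaussianVAR

section Separation

variable {k N p : ℕ}

theorem classBD_subset : classBD.{u} k N p ⊆ classPP k N p ∩ classEBD k N p := fun _ hD =>
  ⟨⟨hD.1, fun t s _ => hD.1.strictlyExogenous_of_bd hD.2 t s⟩, hD.1, hD.2.ebd⟩

theorem exists_mem_classPP_notMem_classBD (hp : 1 ≤ p) {R : Matrix (Fin k) (Fin k) ℝ}
    {A : Matrix (Fin k) (Fin N) ℝ} (hR : Summable fun n : ℕ => R ^ n) (hA : A ≠ 0) :
    ∃ D : DGP.{u} k N, D ∈ classPP k N p ∩ classEBD k N p ∧ D ∉ classBD k N p ∧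
      D.IsVAR 1 fun _ => Matrix.fromBlocks R A 0 0 := by
  obtain ⟨D, hD, hcov, hVAR⟩ := exists_finitePredictorExact_of_summable_pow.{u}
    (summable_fromBlocks_zero₂₁_pow hR summable_zero_pow A) hp
  have hpp := presentPastExogenous_of_isVAR hVAR (D.preDetermined_iff_sigmaXUZero.2 hcov)
  exact ⟨D, ⟨⟨hD, hpp⟩, hD, hD.ebd_iff_sigmaXUZero.2 hcov⟩, fun hBD => hA
    (eq_zero_of_isVAR_of_strictlyExogenous hVAR (hD.strictlyExogenous_of_bd hBD.2) (hD.posDef 0)),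
    hVAR⟩

theorem exists_mem_classEBD_notMem_classPP (hp : 1 ≤ p) {R : Matrix (Fin k) (Fin k) ℝ}
    {A : Matrix (Fin k) (Fin N) ℝ} {S : Matrix (Fin N) (Fin N) ℝ}
    (hR : Summable fun n : ℕ => R ^ n) (hS : Summable fun n : ℕ => S ^ n) (hS' : IsUnit S)
    (hA : A ≠ 0) : ∃ D : DGP.{u} k N, D ∈ classEBD k N p ∧ D ∉ classPP k N p ∧
      D.IsVAR 1 fun _ => Matrix.fromBlocks R A 0 S := by
  obtain ⟨D, hD, hcov, hVAR⟩ := exists_finitePredictorExact_of_summable_pow.{u}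
    (summable_fromBlocks_zero₂₁_pow hR hS A) hp
  exact ⟨D, ⟨hD, hD.ebd_iff_sigmaXUZero.2 hcov⟩, fun hPP => hA
    (eq_zero_of_isVAR_of_presentPastExogenous hVAR hS' hcov hPP.2 (hD.posDef 0)), hVAR⟩

theorem classBD_ssubset [Nonempty (Fin k)] [Nonempty (Fin N)] (hp : 1 ≤ p) :
    classBD.{u} k N p ⊂ classPP k N p ∩ classEBD k N p := by
  obtain ⟨A, hA⟩ := exists_ne (0 : Matrix (Fin k) (Fin N) ℝ)
  obtain ⟨D, hmem, hnotMem, -⟩ := exists_mem_classPP_notMem_classBD.{u} hp summable_zero_pow hA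
  exact classBD_subset.ssubset_of_mem_notMem hmem hnotMem

theorem classPP_inter_classEBD_ssubset [Nonempty (Fin k)] [Nonempty (Fin N)] (hp : 1 ≤ p) :
    classPP.{u} k N p ∩ classEBD k N p ⊂ classEBD k N p := by
  obtain ⟨A, hA⟩ := exists_ne (0 : Matrix (Fin k) (Fin N) ℝ)
  have hhalf : ‖(1 / 2 : ℝ)‖ < 1 := by norm_num
  obtain ⟨D, hmem, hnotMem, -⟩ := exists_mem_classEBD_notMem_classPP.{u} hp
    (summable_smul_one_pow hhalf) (summable_smul_one_pow hhalf)
    ((isUnit_one (M := Matrix (Fin N) (Fin N) ℝ)).smul (Units.mk0 (1 / 2 : ℝ) (by norm_num))) hA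
  exact Set.inter_subset_right.ssubset_of_mem_notMem hmem fun h => hnotMem h.1

end Separation

end DGP

theorem proposition2 (k N p : ℕ) (hk : 1 ≤ k) (hN : 1 ≤ N) (hp : 1 ≤ p) :
    -- (i) strict exogeneity and BD are equivalent
    (∀ D : DGP.{u} k N, D.FinitePredictorExact p → (D.StrictlyExogenous ↔ D.BD p)) ∧
    -- (ii) pre-determinedness, EBD and the restriction on the innovation covariance coincide
    (∀ D : DGP.{u} k N, D.FinitePredictorExact p →
      (D.PreDetermined ↔ D.EBD p) ∧ (D.EBD p ↔ D.SigmaXUZero)) ∧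
    -- (iii) strict nesting of the classes
    (DGP.classBD.{u} k N p ⊂ DGP.classPP.{u} k N p ∩ DGP.classEBD.{u} k N p ∧
      DGP.classPP.{u} k N p ∩ DGP.classEBD.{u} k N p ⊂ DGP.classEBD.{u} k N p) ∧
    -- scalar VAR(1) processes that separate the classes
    (∀ γ : ℝ, γ ≠ 0 →
      ∃ D : DGP.{u} 1 1, D ∈ DGP.classPP.{u} 1 1 1 ∩ DGP.classEBD.{u} 1 1 1 ∧
        D ∉ DGP.classBD.{u} 1 1 1 ∧
        D.IsVAR 1 (fun _ => Matrix.fromBlocks !![0] !![γ] !![0] !![0])) ∧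
    (∀ ρx ρu α : ℝ, |ρx| < 1 → |ρu| < 1 → ρu ≠ 0 → α ≠ 0 →
      ∃ D : DGP.{u} 1 1, D ∈ DGP.classEBD.{u} 1 1 1 ∧
        D ∉ DGP.classPP.{u} 1 1 1 ∩ DGP.classEBD.{u} 1 1 1 ∧
        D.IsVAR 1 (fun _ => Matrix.fromBlocks !![ρx] !![α] !![0] !![ρu])) := by
  have : Nonempty (Fin k) := ⟨⟨0, hk⟩⟩
  have : Nonempty (Fin N) := ⟨⟨0, hN⟩⟩
  have hscalar : ∀ a : ℝ, !![a] = a • (1 : Matrix (Fin 1) (Fin 1) ℝ) := fun a => by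
    ext i j
    simp [Subsingleton.elim i j]
  have hzero : !![(0 : ℝ)] = 0 := by simp [hscalar]
  have hne : ∀ a : ℝ, a ≠ 0 → !![a] ≠ 0 := fun a ha => by simpa [hscalar] using ha
  refine ⟨fun D hD => hD.strictlyExogenous_iff_bd, fun D hD =>
    ⟨D.preDetermined_iff_sigmaXUZero.trans hD.ebd_iff_sigmaXUZero.symm, hD.ebd_iff_sigmaXUZero⟩,
    ⟨DGP.classBD_ssubset hp, DGP.classPP_inter_classEBD_ssubset hp⟩, fun γ hγ => ?_,
    fun ρx ρu α hx hu hu0 hα => ?_⟩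
  · rw [hzero]
    exact DGP.exists_mem_classPP_notMem_classBD le_rfl summable_zero_pow (hne γ hγ)
  · rw [hzero, hscalar ρx, hscalar ρu]
    obtain ⟨D, hmem, hnotMem, hVAR⟩ := DGP.exists_mem_classEBD_notMem_classPP.{u} le_rfl
      (summable_smul_one_pow hx) (summable_smul_one_pow hu)
      ((isUnit_one (M := Matrix (Fin 1) (Fin 1) ℝ)).smul (Units.mk0 ρu hu0)) (hne α hα)
    exact ⟨D, hmem, fun h => hnotMem h.1, hVAR⟩
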